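/- Let $K\ge 2$, $n\ge 1$ and $d\ge K-1$ be integers. For $W\in\mathbb R^{K\times d}$ with rows $w_1,\dots,w_K$ and $H\in\mathbb R^{d\times Kn}$ with columns $h_{k,i}$ ($1\le k\le K$, $1\le i\le n$), let $$\mathcal L(W,H)=-\sum_{k=1}^K\sum_{i=1}^n\log\left(\frac{\exp(w_k^\top h_{k,i})}{\sum_{j=1}^K\exp(w_j^\top h_{k,i})}\right),\qquad \bar h_k=\frac1n\sum_{i=1}^n h_{k,i}.$$ The tangent space at $(W,H)$ is $$\mathcal T(W,H)=\{(\Delta W,\Delta H)\in\mathbb R^{K\times d}\times\mathbb R^{d\times Kn}:\ \mathrm{tr}(W^\top\Delta W)+\mathrm{tr}(H^\top\Delta H)=0\}.$$ Call $(W,H)$ a neural collapse solution if (NC1) $h_{k,i}=\bar h_k$ for all $k,i$; (NC2) the class means $\bar h_k$ are nonzero with $\|\bar h_k\|=\|\bar h_j\|$ and $\cos(\bar h_k,\bar h_j)=-\frac1{K-1}$ for all $k\ne j$; (NC3) there is $C>0$ with $w_k=C\bar h_k$ for all $k$; and (NC4) $\arg\max_k\langle w_k,h\rangle=\arg\min_k\|h-\bar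 h_k\|$, as sets of indices, for every $h\in\mathbb R^d$. Suppose that $(W,H)$ is not a neural collapse solution or that $\|W\|_F\neq\|H\|_F$. Then the following hold. 1. There are a direction $(\Delta W,\Delta H)\in\mathcal T(W,H)$ and a constant $M>0$ such that $\mathcal L(W+\delta\Delta W,H+\delta\Delta H)<\mathcal L(W,H)$ for all $0<\delta<M$. 2. If $(W,H)\ne(0,0)$, then for every $\epsilon>0$ there is a point $(W',H')$ with $$\|W'\|_F^2+\|H'\|_F^2=\|W\|_F^2+\|H\|_F^2,\quad \|W'-W\|_F^2+\|H'-H\|_F^2<\epsilon,\quad \mathcal L(W',H')<\mathcal L(W,H).$$ 3. If $(W,H)$ is a critical point in the tangent space, i.e. $\frac{d}{dt}\mathcal L(W+t\Delta W,H+t\Delta H)|_{t=0}=0$ for all $(\Delta W,\Delta H)\in\mathcal T(W,H)$, then it is a strict saddle in the tangent space: there is $(\Delta W,\Delta H)\in\mathcal T(W,H)$ with $\frac{d^2}{dt^2}\mathcal L(W+t\Delta W,H+t\Delta H)|_{t=0}<0$; and, if $(W,H)\neq(0,0)$, there is $(\Delta W,\Delta H)\in\mathcal T(W,H)$ with $\|\Delta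 W\|_F^2+\|\Delta H\|_F^2=\|W\|_F^2+\|H\|_F^2$ such that the second derivative at $t=0$ of $\mathcal L$ along the great circle $t\mapsto\cos t\,(W,H)+\sin t\,(\Delta W,\Delta H)$ is negative, i.e. the Riemannian Hessian of $\mathcal L$ on the sphere through $(W,H)$ has a negative eigenvalue. -/

import Mathlib

open scoped Matrix

attribute [local instance] Matrix.frobeniusNormedAddCommGroup

namespace ULPM

/-- The matrix of classifiers: its `k`-th row is the classifier `w_k` of class `k`. -/
abbrev Classifiers (K d : ℕ) : Type := Matrix (Fin K) (Fin d) ℝ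

/-- The matrix of features: its column `(k, i)` is the feature `h_{k,i}` of the `i`-th data point
of class `k`. -/
abbrev Features (K n d : ℕ) : Type := Matrix (Fin d) (Fin K × Fin n) ℝ

noncomputable section

variable {K n d : ℕ}

/-- The cross-entropy loss of the unconstrained layer-peeled model. -/
def loss (W : Classifiers K d) (H : Features K n d) : ℝ :=
  -∑ k : Fin K, ∑ i : Fin n,
    Real.log (Real.exp ((W * H) k (k, i)) / ∑ j : Fin K, Real.exp ((W * H) j (k, i)))

/-- The classifier `w_k`, as a vector of Euclidean space. -/
def classifier (W : Classifiers K d) (k : Fin K) : EuclideanSpace ℝ (Fin d) :=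
  WithLp.toLp 2 (fun a => W k a)

/-- The feature `h_{k,i}`, as a vector of Euclidean space. -/
def feature (H : Features K n d) (k : Fin K) (i : Fin n) : EuclideanSpace ℝ (Fin d) :=
  WithLp.toLp 2 (fun a => H a (k, i))

/-- The mean of the features of class `k`. -/
def classMean (H : Features K n d) (k : Fin K) : EuclideanSpace ℝ (Fin d) :=
  (n : ℝ)⁻¹ • ∑ i : Fin n, feature H k i

/-- The neural collapse conditions. The cosine is that of Mathlib's angle; it is `0` when one of the
vectors is zero, so that `nc2` never holds for vanishing class means. -/
structure IsNeuralCollapse (W : Classifiers K d) (H : Features K n d) : Prop where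
  /-- variability collapse -/
  nc1 : ∀ (k : Fin K) (i : Fin n), ‖feature H k i - classMean H k‖ = 0
  /-- the class means form a simplex equiangular tight frame -/
  nc2 : ∀ k j : Fin K, k ≠ j →
    Real.cos (InnerProductGeometry.angle (classMean H k) (classMean H j)) = -1 / ((K : ℝ) - 1) ∧
      ‖classMean H k‖ = ‖classMean H j‖
  /-- self-duality -/
  nc3 : ∃ C : ℝ, 0 < C ∧ ∀ k : Fin K, classifier W k = C • classMean H k
  /-- the classifier chooses the class with the nearest class mean -/
  nc4 : ∀ (h : EuclideanSpace ℝ (Fin d)) (k : Fin K),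
    (∀ j : Fin K, inner ℝ (classifier W j) h ≤ inner ℝ (classifier W k) h) ↔
      ∀ j : Fin K, ‖h - classMean H k‖ ≤ ‖h - classMean H j‖

/-- The squared norm `‖W‖_F² + ‖H‖_F²` of a point. -/
def normSq (W : Classifiers K d) (H : Features K n d) : ℝ := ‖W‖ ^ 2 + ‖H‖ ^ 2

/-- The tangent space: the directions that are orthogonal to `(W, H)`. -/
def tangentSpace (W : Classifiers K d) (H : Features K n d) :
    Set (Classifiers K d × Features K n d) :=
  {Δ | (Wᵀ * Δ.1).trace + (Hᵀ * Δ.2).trace = 0}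

/-- `(W, H)` is a critical point in the tangent space: the derivative of the loss at `(W, H)`
vanishes in every tangent direction. -/
def IsTangentCritical (W : Classifiers K d) (H : Features K n d) : Prop :=
  ∀ Δ ∈ tangentSpace W H, deriv (fun t : ℝ => loss (W + t • Δ.1) (H + t • Δ.2)) 0 = 0

/-- `(W, H)` is a strict saddle in the tangent space: a critical point such that the Hessian of the
loss is negative in some tangent direction and, unless the sphere through `(W, H)` degenerates to
the origin, the Riemannian Hessian of the loss on that sphere (its second derivative along
geodesics, which are great circles) is negative in some tangent direction. -/
def IsTangentStrictSaddle (W : Classifiers K d) (H : Features K n d) : Prop :=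
  IsTangentCritical W H ∧
  (∃ Δ ∈ tangentSpace W H,
    iteratedDeriv 2 (fun t : ℝ => loss (W + t • Δ.1) (H + t • Δ.2)) 0 < 0) ∧
  ((W, H) ≠ 0 → ∃ Δ ∈ tangentSpace W H, normSq Δ.1 Δ.2 = normSq W H ∧
    iteratedDeriv 2 (fun t : ℝ =>
      loss (Real.cos t • W + Real.sin t • Δ.1) (Real.cos t • H + Real.sin t • Δ.2)) 0 < 0)

end

end ULPM

namespace ULPM

/-! Write `Z = W * H` and `G = logitGrad Z`. A tangent-critical point satisfies `G * Hᵀ = -lam • W`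
and `Wᵀ * G = -lam • H`. In a direction `(V, F)` the Hessian is `2⟨G, V F⟩` plus a variance term in
`V H + W F`, and the curvature of the sphere adds `lam (‖V‖² + ‖F‖²)`. `exists_neg_direction` makes
both quantities negative.

If `lam < 0`, the direction `(W, -H)` does not move the logits to first order and suffices.
Otherwise rank-one directions `V = u aᵀ`, `F = r a (Gᵀ u)ᵀ` are used, with `W a` constant (`lam =
0`) or zero (`lam > 0`), so that `W F` does not affect the variance term.

If `lam > 0` and `G` has operator norm at most `lam`, convexity of the loss in the logits makes the
point a global minimiser of loss plus `lam / 2` times the squared norm. Relabelling classes gives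
another minimiser, and strict convexity modulo column shifts makes `Z` permutation invariant, which
forces neural collapse. Hence some `u` has `‖Gᵀ u‖ > lam ‖u‖`. A vector `a ≠ 0` with `W a = 0` then
exists: otherwise `d ≥ K - 1` lets `W` and the constants span all `u`, and on that span the critical
equations bound `Gᵀ` by `lam`.

At a non-critical point the first derivative already gives descent. -/

/-- The Frobenius inner product of two real matrices. -/
noncomputable def frob {m l : Type*} [Fintype m] [Fintype l] (A B : Matrix m l ℝ) : ℝ :=
  (Aᵀ * B).trace

/-! ### Frobenius inner product. -/

section frob

variable {m l o : Type*} [Fintype m] [Fintype l] [Fintype o]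

theorem frob_eq_sum (A B : Matrix m l ℝ) : frob A B = ∑ x, ∑ j, A j x * B j x := by
  simp [frob, Matrix.trace, Matrix.mul_apply]

theorem frob_comm (A B : Matrix m l ℝ) : frob A B = frob B A := by
  simp [frob_eq_sum, mul_comm]

theorem frob_add_left (A B C : Matrix m l ℝ) : frob (A + B) C = frob A C + frob B C := by
  simp [frob, Matrix.add_mul]

theorem frob_add_right (A B C : Matrix m l ℝ) : frob A (B + C) = frob A B + frob A C := by
  simp [frob, Matrix.mul_add]

theorem frob_sub_right (A B C : Matrix m l ℝ) : frob A (B - C) = frob A B - frob A C := by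
  simp [frob, Matrix.mul_sub]

theorem frob_smul_left (r : ℝ) (A B : Matrix m l ℝ) : frob (r • A) B = r * frob A B := by
  simp [frob]

theorem frob_smul_right (r : ℝ) (A B : Matrix m l ℝ) : frob A (r • B) = r * frob A B := by
  simp [frob]

theorem frob_neg_right (A B : Matrix m l ℝ) : frob A (-B) = -frob A B := by
  simp [frob]

theorem frob_zero_right (A : Matrix m l ℝ) : frob A 0 = 0 := by
  simp [frob]

theorem frob_self (A : Matrix m l ℝ) : frob A A = ‖A‖ ^ 2 := by
  rw [Matrix.frobenius_norm_def, ← Real.sqrt_eq_rpow, Real.sq_sqrt (by positivity), frob_eq_sum,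
    Finset.sum_comm]
  simp [sq_abs, ← pow_two]

theorem frob_self_nonneg (A : Matrix m l ℝ) : 0 ≤ frob A A := by
  rw [frob_self]; positivity

theorem frob_self_eq_zero {A : Matrix m l ℝ} : frob A A = 0 ↔ A = 0 := by
  rw [frob_self, sq_eq_zero_iff, norm_eq_zero]

theorem frob_mul_transpose_left (G : Matrix m l ℝ) (H : Matrix o l ℝ) (D : Matrix m o ℝ) :
    frob (G * Hᵀ) D = frob G (D * H) := by
  rw [frob, frob, Matrix.transpose_mul, Matrix.transpose_transpose, Matrix.mul_assoc,
    Matrix.trace_mul_comm, Matrix.mul_assoc]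

theorem frob_transpose_mul_left (W : Matrix m o ℝ) (G : Matrix m l ℝ) (D : Matrix o l ℝ) :
    frob (Wᵀ * G) D = frob G (W * D) := by
  rw [frob, frob, Matrix.transpose_mul, Matrix.transpose_transpose, Matrix.mul_assoc]

theorem frob_vecMulVec_right (G : Matrix m l ℝ) (u : m → ℝ) (v : l → ℝ) :
    frob G (Matrix.vecMulVec u v) = u ⬝ᵥ (G *ᵥ v) := by
  simp only [frob_eq_sum, Matrix.vecMulVec_apply, dotProduct, Matrix.mulVec, Finset.mul_sum]
  rw [Finset.sum_comm]
  exact Finset.sum_congr rfl fun _ _ => Finset.sum_congr rfl fun _ _ => by ring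

end frob

/-! ### Cross-entropy as a convex function of the logits. -/

section CrossEntropy

variable {K n : ℕ}

/-- The cross-entropy loss as a function of the logits. -/
noncomputable def logitLoss (Z : Matrix (Fin K) (Fin K × Fin n) ℝ) : ℝ :=
  ∑ x, (Real.log (∑ j, Real.exp (Z j x)) - Z x.1 x)

/-- The class probabilities that belong to the logits. -/
noncomputable def softmax (Z : Matrix (Fin K) (Fin K × Fin n) ℝ) :
    Matrix (Fin K) (Fin K × Fin n) ℝ :=
  Matrix.of fun j x => Real.exp (Z j x) / ∑ i, Real.exp (Z i x)

/-- The gradient of the cross-entropy loss with respect to the logits. -/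
noncomputable def logitGrad (Z : Matrix (Fin K) (Fin K × Fin n) ℝ) :
    Matrix (Fin K) (Fin K × Fin n) ℝ :=
  Matrix.of fun j x => softmax Z j x - if j = x.1 then 1 else 0

/-- The Hessian quadratic form of the cross-entropy loss with respect to the logits. -/
noncomputable def logitHess (Z A : Matrix (Fin K) (Fin K × Fin n) ℝ) : ℝ :=
  ∑ x, (∑ j, softmax Z j x * A j x ^ 2 - (∑ j, softmax Z j x * A j x) ^ 2)

theorem sum_exp_pos (Z : Matrix (Fin K) (Fin K × Fin n) ℝ) (x : Fin K × Fin n) :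
    0 < ∑ j, Real.exp (Z j x) :=
  Finset.sum_pos (fun _ _ => Real.exp_pos _) ⟨x.1, Finset.mem_univ _⟩

theorem softmax_pos (Z : Matrix (Fin K) (Fin K × Fin n) ℝ) (j : Fin K) (x : Fin K × Fin n) :
    0 < softmax Z j x :=
  div_pos (Real.exp_pos _) (sum_exp_pos Z x)

theorem sum_softmax (Z : Matrix (Fin K) (Fin K × Fin n) ℝ) (x : Fin K × Fin n) :
    ∑ j, softmax Z j x = 1 := by
  simp only [softmax, Matrix.of_apply, ← Finset.sum_div]
  exact div_self (sum_exp_pos Z x).ne'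

theorem sum_logitGrad (Z : Matrix (Fin K) (Fin K × Fin n) ℝ) (x : Fin K × Fin n) :
    ∑ j, logitGrad Z j x = 0 := by
  simp [logitGrad, sum_softmax]

theorem frob_logitGrad (Z D : Matrix (Fin K) (Fin K × Fin n) ℝ) :
    frob (logitGrad Z) D = ∑ x, (∑ j, softmax Z j x * D j x - D x.1 x) := by
  simp [frob_eq_sum, logitGrad, sub_mul]

theorem loss_eq_logitLoss {d : ℕ} (W : Classifiers K d) (H : Features K n d) :
    loss W H = logitLoss (W * H) := by
  rw [loss, logitLoss, Fintype.sum_prod_type, ← Finset.sum_neg_distrib]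
  refine Finset.sum_congr rfl fun k _ => ?_
  rw [← Finset.sum_neg_distrib]
  refine Finset.sum_congr rfl fun i _ => ?_
  rw [Real.log_div (Real.exp_pos _).ne' (sum_exp_pos (W * H) (k, i)).ne', Real.log_exp]
  ring

theorem hasDerivAt_logitLoss {Z : ℝ → Matrix (Fin K) (Fin K × Fin n) ℝ}
    {Z' : Matrix (Fin K) (Fin K × Fin n) ℝ} {t : ℝ}
    (hZ : ∀ j x, HasDerivAt (fun s => Z s j x) (Z' j x) t) :
    HasDerivAt (fun s => logitLoss (Z s)) (frob (logitGrad (Z t)) Z') t := by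
  rw [frob_logitGrad]
  refine HasDerivAt.fun_sum fun x _ => HasDerivAt.sub ?_ (hZ x.1 x)
  have h := (HasDerivAt.fun_sum (u := Finset.univ) fun j _ => (hZ j x).exp).log
    (sum_exp_pos (Z t) x).ne'
  refine h.congr_deriv ?_
  simp only [softmax, Matrix.of_apply, Finset.sum_div]
  exact Finset.sum_congr rfl fun j _ => by ring

theorem hasDerivAt_softmax {Z : ℝ → Matrix (Fin K) (Fin K × Fin n) ℝ}
    {Z' : Matrix (Fin K) (Fin K × Fin n) ℝ} {t : ℝ}
    (hZ : ∀ j x, HasDerivAt (fun s => Z s j x) (Z' j x) t) (j : Fin K) (x : Fin K × Fin n) :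
    HasDerivAt (fun s => softmax (Z s) j x)
      (softmax (Z t) j x * (Z' j x - ∑ i, softmax (Z t) i x * Z' i x)) t := by
  have hS := sum_exp_pos (Z t) x
  have h := (hZ j x).exp.div
    (HasDerivAt.fun_sum (u := Finset.univ) fun i _ => (hZ i x).exp) hS.ne'
  have e : ∑ i, softmax (Z t) i x * Z' i x =
      (∑ i, Real.exp (Z t i x) * Z' i x) / ∑ i, Real.exp (Z t i x) := by
    rw [Finset.sum_div]
    exact Finset.sum_congr rfl fun i _ => by simp only [softmax, Matrix.of_apply]; ring
  refine h.congr_deriv ?_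
  rw [e]
  simp only [softmax, Matrix.of_apply]
  field_simp

theorem hasDerivAt_frob_logitGrad {Z Z' : ℝ → Matrix (Fin K) (Fin K × Fin n) ℝ}
    {Z'' : Matrix (Fin K) (Fin K × Fin n) ℝ} {t : ℝ}
    (hZ : ∀ j x, HasDerivAt (fun s => Z s j x) (Z' t j x) t)
    (hZ' : ∀ j x, HasDerivAt (fun s => Z' s j x) (Z'' j x) t) :
    HasDerivAt (fun s => frob (logitGrad (Z s)) (Z' s))
      (frob (logitGrad (Z t)) Z'' + logitHess (Z t) (Z' t)) t := by
  have h : HasDerivAt (fun s => ∑ x, (∑ j, softmax (Z s) j x * Z' s j x - Z' s x.1 x)) _ t :=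
    HasDerivAt.fun_sum fun x _ => HasDerivAt.sub
      (HasDerivAt.fun_sum fun j _ => (hasDerivAt_softmax hZ j x).mul (hZ' j x)) (hZ' x.1 x)
  simp only [frob_logitGrad]
  refine h.congr_deriv ?_
  rw [logitHess, ← Finset.sum_add_distrib]
  refine Finset.sum_congr rfl fun x _ => ?_
  have e (m : ℝ) : ∑ j, softmax (Z t) j x * (Z' t j x - m) * Z' t j x =
      ∑ j, softmax (Z t) j x * Z' t j x ^ 2 - (∑ j, softmax (Z t) j x * Z' t j x) * m := by
    rw [Finset.sum_mul, ← Finset.sum_sub_distrib]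
    exact Finset.sum_congr rfl fun j _ => by ring
  rw [Finset.sum_add_distrib, e]
  ring

theorem iteratedDeriv_two_logitLoss {Z Z' Z'' : ℝ → Matrix (Fin K) (Fin K × Fin n) ℝ}
    (hZ : ∀ t j x, HasDerivAt (fun s => Z s j x) (Z' t j x) t)
    (hZ' : ∀ t j x, HasDerivAt (fun s => Z' s j x) (Z'' t j x) t) (t : ℝ) :
    iteratedDeriv 2 (fun s => logitLoss (Z s)) t =
      frob (logitGrad (Z t)) (Z'' t) + logitHess (Z t) (Z' t) := by
  rw [iteratedDeriv_succ, iteratedDeriv_one,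
    funext fun s => (hasDerivAt_logitLoss (hZ s)).deriv]
  exact (hasDerivAt_frob_logitGrad (hZ t) (hZ' t)).deriv

theorem logitHess_smul (Z A : Matrix (Fin K) (Fin K × Fin n) ℝ) (r : ℝ) :
    logitHess Z (r • A) = r ^ 2 * logitHess Z A := by
  rw [logitHess, logitHess, Finset.mul_sum]
  refine Finset.sum_congr rfl fun x _ => ?_
  have e : ∑ j, softmax Z j x * (r • A) j x = r * ∑ j, softmax Z j x * A j x := by
    rw [Finset.mul_sum]
    exact Finset.sum_congr rfl fun j _ => by simp only [Matrix.smul_apply, smul_eq_mul]; ring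
  have e' : ∑ j, softmax Z j x * (r • A) j x ^ 2 = r ^ 2 * ∑ j, softmax Z j x * A j x ^ 2 := by
    rw [Finset.mul_sum]
    exact Finset.sum_congr rfl fun j _ => by simp only [Matrix.smul_apply, smul_eq_mul]; ring
  rw [e, e']
  ring

theorem logitHess_zero (Z : Matrix (Fin K) (Fin K × Fin n) ℝ) : logitHess Z 0 = 0 := by
  simp [logitHess]

/-- Each summand of `logitHess` is the variance of a column of `A` under the softmax probabilities,
hence blind to constants. -/
theorem logitHess_add_const (Z A C : Matrix (Fin K) (Fin K × Fin n) ℝ) {v : Fin K × Fin n → ℝ}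
    (hC : ∀ j x, C j x = v x) : logitHess Z (A + C) = logitHess Z A := by
  refine Finset.sum_congr rfl fun x _ => ?_
  have h1 : ∑ j, softmax Z j x * (A j x + v x) = ∑ j, softmax Z j x * A j x + v x := by
    simp only [mul_add, Finset.sum_add_distrib, ← Finset.sum_mul, sum_softmax, one_mul]
  have h2 : ∑ j, softmax Z j x * (A j x + v x) ^ 2 =
      ∑ j, softmax Z j x * A j x ^ 2 + 2 * v x * ∑ j, softmax Z j x * A j x + v x ^ 2 := by
    have e : ∑ j, softmax Z j x * v x ^ 2 = v x ^ 2 := by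
      rw [← Finset.sum_mul, sum_softmax, one_mul]
    rw [← e, Finset.mul_sum, ← Finset.sum_add_distrib, ← Finset.sum_add_distrib]
    exact Finset.sum_congr rfl fun j _ => by ring
  simp only [Matrix.add_apply, hC]
  rw [h1, h2]
  ring

/-- Off-diagonal entries of the gradient are softmax probabilities, hence positive; two classes are
needed for one to exist. -/
theorem logitGrad_ne_zero (hK : 2 ≤ K) (hn : 1 ≤ n) (Z : Matrix (Fin K) (Fin K × Fin n) ℝ) :
    logitGrad Z ≠ 0 := by
  intro h
  have h1 := congrFun (congrFun h ⟨0, by omega⟩) (⟨1, by omega⟩, ⟨0, by omega⟩)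
  have h2 := softmax_pos Z ⟨0, by omega⟩ (⟨1, by omega⟩, ⟨0, by omega⟩)
  simp [logitGrad] at h1
  exact h2.ne' h1

/-- The cross-entropy loss lies above its tangent planes, and touches them only along shifts of the
columns by constants. -/
theorem eq_const_of_logitLoss_le {Z Z' : Matrix (Fin K) (Fin K × Fin n) ℝ}
    (h : logitLoss Z' ≤ logitLoss Z + frob (logitGrad Z) (Z' - Z)) (x : Fin K × Fin n) :
    ∃ c, ∀ j, Z' j x - Z j x = c := by
  -- The softmax mean of the increment is its pairing with the linear part of log-sum-exp. After
  -- factoring out `exp (m y)`, the remainder is at least 1 by `x + 1 ≤ exp x`, strictly unless the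
  -- increment equals its mean.
  set m : Fin K × Fin n → ℝ := fun y => ∑ j, softmax Z j y * (Z' j y - Z j y) with hm
  have key (y) : ∑ j, Real.exp (Z' j y) = (∑ j, Real.exp (Z j y)) * Real.exp (m y) *
      ∑ j, softmax Z j y * Real.exp (Z' j y - Z j y - m y) := by
    rw [Finset.mul_sum]
    refine Finset.sum_congr rfl fun j _ => ?_
    rw [Real.exp_sub, Real.exp_sub]
    simp only [softmax, Matrix.of_apply]
    have := (sum_exp_pos Z y).ne'
    field_simp
  have e1 (y) : ∑ j, softmax Z j y * (Z' j y - Z j y - m y + 1) = 1 := by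
    have : ∑ j, softmax Z j y * (Z' j y - Z j y - m y + 1) =
        ∑ j, softmax Z j y * (Z' j y - Z j y) - (∑ j, softmax Z j y) * (m y - 1) := by
      rw [Finset.sum_mul, ← Finset.sum_sub_distrib]
      exact Finset.sum_congr rfl fun j _ => by ring
    rw [this, sum_softmax, hm]
    ring
  have ge1 (y) : 1 ≤ ∑ j, softmax Z j y * Real.exp (Z' j y - Z j y - m y) := by
    rw [← e1 y]
    exact Finset.sum_le_sum fun j _ =>
      mul_le_mul_of_nonneg_left (Real.add_one_le_exp _) (softmax_pos Z j y).le
  have logeq (y) : Real.log (∑ j, Real.exp (Z' j y)) = Real.log (∑ j, Real.exp (Z j y)) + m y +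
      Real.log (∑ j, softmax Z j y * Real.exp (Z' j y - Z j y - m y)) := by
    rw [key, Real.log_mul (mul_pos (sum_exp_pos Z y) (Real.exp_pos _)).ne' (by linarith [ge1 y]),
      Real.log_mul (sum_exp_pos Z y).ne' (Real.exp_pos _).ne', Real.log_exp]
  have hsum : ∑ y, Real.log (∑ j, softmax Z j y * Real.exp (Z' j y - Z j y - m y)) ≤ 0 := by
    have : logitLoss Z' = logitLoss Z + frob (logitGrad Z) (Z' - Z) +
        ∑ y, Real.log (∑ j, softmax Z j y * Real.exp (Z' j y - Z j y - m y)) := by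
      rw [frob_logitGrad, logitLoss, logitLoss, ← Finset.sum_add_distrib, ← Finset.sum_add_distrib]
      refine Finset.sum_congr rfl fun y _ => ?_
      rw [logeq]
      simp only [hm, Matrix.sub_apply]
      ring
    linarith
  have hx : Real.log (∑ j, softmax Z j x * Real.exp (Z' j x - Z j x - m x)) ≤ 0 :=
    (Finset.single_le_sum (fun y _ => Real.log_nonneg (ge1 y)) (Finset.mem_univ x)).trans hsum
  refine ⟨m x, fun j => ?_⟩
  by_contra hj
  have : 1 < ∑ j, softmax Z j x * Real.exp (Z' j x - Z j x - m x) := by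
    rw [← e1 x]
    exact Finset.sum_lt_sum (fun i _ => mul_le_mul_of_nonneg_left (Real.add_one_le_exp _)
      (softmax_pos Z i x).le) ⟨j, Finset.mem_univ _, mul_lt_mul_of_pos_left
      (Real.add_one_lt_exp (sub_ne_zero.2 hj)) (softmax_pos Z j x)⟩
  exact absurd (Real.log_pos this) hx.not_gt

end CrossEntropy

/-! ### Derivatives of the loss along lines and great circles. -/

section Curves

variable {K n d : ℕ}

/-- The Hessian quadratic form of the loss with respect to the factors. -/
noncomputable def lineHess (W : Classifiers K d) (H : Features K n d) (V : Classifiers K d)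
    (F : Features K n d) : ℝ :=
  2 * frob (logitGrad (W * H)) (V * F) + logitHess (W * H) (V * H + W * F)

theorem lineHess_smul (W V : Classifiers K d) (H F : Features K n d) (r : ℝ) :
    lineHess W H (r • V) (r • F) = r ^ 2 * lineHess W H V F := by
  have e : r • V * H + W * r • F = r • (V * H + W * F) := by simp
  have e' : r • V * r • F = r ^ 2 • (V * F) := by simp [smul_smul, sq]
  rw [lineHess, lineHess, e, e', logitHess_smul, frob_smul_right]
  ring

theorem line_mul (W V : Classifiers K d) (H F : Features K n d) (t : ℝ) :
    (W + t • V) * (H + t • F) = W * H + t • (V * H + W * F) + t ^ 2 • (V * F) := by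
  simp only [Matrix.add_mul, Matrix.mul_add, Matrix.smul_mul, Matrix.mul_smul, smul_smul, smul_add,
    sq]
  abel

theorem circle_mul (W V : Classifiers K d) (H F : Features K n d) (t : ℝ) :
    (Real.cos t • W + Real.sin t • V) * (Real.cos t • H + Real.sin t • F) =
      Real.cos t ^ 2 • (W * H) + (Real.sin t * Real.cos t) • (V * H + W * F) +
        Real.sin t ^ 2 • (V * F) := by
  simp only [Matrix.add_mul, Matrix.mul_add, Matrix.smul_mul, Matrix.mul_smul, smul_smul, smul_add,
    sq, mul_comm (Real.cos t) (Real.sin t)]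
  abel

theorem hasDerivAt_line (Z A B : Matrix (Fin K) (Fin K × Fin n) ℝ) (t : ℝ) (j : Fin K)
    (x : Fin K × Fin n) :
    HasDerivAt (fun s : ℝ => (Z + s • A + s ^ 2 • B) j x) ((A + (2 * t) • B) j x) t := by
  simp only [Matrix.add_apply, Matrix.smul_apply, smul_eq_mul]
  refine ((((hasDerivAt_id' t).mul_const (A j x)).const_add (Z j x)).add
    ((hasDerivAt_pow 2 t).mul_const (B j x))).congr_deriv ?_
  simp

theorem hasDerivAt_line_deriv (A B : Matrix (Fin K) (Fin K × Fin n) ℝ) (t : ℝ) (j : Fin K)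
    (x : Fin K × Fin n) :
    HasDerivAt (fun s : ℝ => (A + (2 * s) • B) j x) (((2 : ℝ) • B) j x) t := by
  simp only [Matrix.add_apply, Matrix.smul_apply, smul_eq_mul]
  refine ((((hasDerivAt_id' t).const_mul 2).mul_const (B j x)).const_add (A j x)).congr_deriv ?_
  simp

theorem hasDerivAt_circle (Z A B : Matrix (Fin K) (Fin K × Fin n) ℝ) (t : ℝ) (j : Fin K)
    (x : Fin K × Fin n) :
    HasDerivAt (fun s : ℝ => (Real.cos s ^ 2 • Z + (Real.sin s * Real.cos s) • A +
      Real.sin s ^ 2 • B) j x) (((Real.cos t ^ 2 - Real.sin t ^ 2) • A +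
        (2 * (Real.sin t * Real.cos t)) • (B - Z)) j x) t := by
  simp only [Matrix.add_apply, Matrix.smul_apply, Matrix.sub_apply, smul_eq_mul]
  have hc := Real.hasDerivAt_cos t
  have hs := Real.hasDerivAt_sin t
  refine ((((hc.pow 2).mul_const (Z j x)).add ((hs.mul hc).mul_const (A j x))).add
    ((hs.pow 2).mul_const (B j x))).congr_deriv ?_
  simp only [Nat.cast_ofNat, Nat.add_one_sub_one, pow_one]
  ring

theorem hasDerivAt_circle_deriv (Z A B : Matrix (Fin K) (Fin K × Fin n) ℝ) (t : ℝ) (j : Fin K)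
    (x : Fin K × Fin n) :
    HasDerivAt (fun s : ℝ => ((Real.cos s ^ 2 - Real.sin s ^ 2) • A +
      (2 * (Real.sin s * Real.cos s)) • (B - Z)) j x)
      (((-4 * (Real.sin t * Real.cos t)) • A +
        (2 * (Real.cos t ^ 2 - Real.sin t ^ 2)) • (B - Z)) j x) t := by
  simp only [Matrix.add_apply, Matrix.smul_apply, Matrix.sub_apply, smul_eq_mul]
  have hc := Real.hasDerivAt_cos t
  have hs := Real.hasDerivAt_sin t
  refine ((((hc.pow 2).sub (hs.pow 2)).mul_const (A j x)).add
    (((hs.mul hc).const_mul 2).mul_const (B j x - Z j x))).congr_deriv ?_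
  simp only [Nat.cast_ofNat, Nat.add_one_sub_one, pow_one]
  ring

theorem hasDerivAt_loss_line (W V : Classifiers K d) (H F : Features K n d) :
    HasDerivAt (fun t : ℝ => loss (W + t • V) (H + t • F))
      (frob (logitGrad (W * H)) (V * H + W * F)) 0 := by
  simp only [loss_eq_logitLoss, line_mul]
  simpa using hasDerivAt_logitLoss (hasDerivAt_line (W * H) (V * H + W * F) (V * F) 0)

/-- A great circle and its tangent line have the same velocity, so criticality passes from one to
the other. -/
theorem hasDerivAt_loss_circle (W V : Classifiers K d) (H F : Features K n d) :
    HasDerivAt (fun t : ℝ =>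
      loss (Real.cos t • W + Real.sin t • V) (Real.cos t • H + Real.sin t • F))
      (frob (logitGrad (W * H)) (V * H + W * F)) 0 := by
  simp only [loss_eq_logitLoss, circle_mul]
  simpa using hasDerivAt_logitLoss (hasDerivAt_circle (W * H) (V * H + W * F) (V * F) 0)

theorem iteratedDeriv_loss_line (W V : Classifiers K d) (H F : Features K n d) :
    iteratedDeriv 2 (fun t : ℝ => loss (W + t • V) (H + t • F)) 0 = lineHess W H V F := by
  simp only [loss_eq_logitLoss, line_mul]
  rw [iteratedDeriv_two_logitLoss (hasDerivAt_line (W * H) (V * H + W * F) (V * F))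
    (hasDerivAt_line_deriv (V * H + W * F) (V * F)), lineHess, frob_smul_right]
  simp

/-- The extra term comes from the acceleration `-(W, H)` of the circle, paired with the gradient. -/
theorem iteratedDeriv_loss_circle (W V : Classifiers K d) (H F : Features K n d) :
    iteratedDeriv 2 (fun t : ℝ =>
      loss (Real.cos t • W + Real.sin t • V) (Real.cos t • H + Real.sin t • F)) 0 =
      lineHess W H V F - 2 * frob (logitGrad (W * H)) (W * H) := by
  simp only [loss_eq_logitLoss, circle_mul]
  rw [iteratedDeriv_two_logitLoss (hasDerivAt_circle (W * H) (V * H + W * F) (V * F))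
    (hasDerivAt_circle_deriv (W * H) (V * H + W * F) (V * F)), lineHess]
  simp [frob_smul_right, frob_sub_right]
  ring

theorem differentiable_loss_line (W V : Classifiers K d) (H F : Features K n d) :
    Differentiable ℝ (fun t : ℝ => loss (W + t • V) (H + t • F)) := by
  simp only [loss_eq_logitLoss, line_mul]
  exact fun t => (hasDerivAt_logitLoss
    (hasDerivAt_line (W * H) (V * H + W * F) (V * F) t)).differentiableAt

theorem differentiable_loss_circle (W V : Classifiers K d) (H F : Features K n d) :
    Differentiable ℝ (fun t : ℝ =>
      loss (Real.cos t • W + Real.sin t • V) (Real.cos t • H + Real.sin t • F)) := by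
  simp only [loss_eq_logitLoss, circle_mul]
  exact fun t => (hasDerivAt_logitLoss
    (hasDerivAt_circle (W * H) (V * H + W * F) (V * F) t)).differentiableAt

end Curves

/-! ### Descent from first and second derivatives. -/

section Descent

theorem exists_forall_lt_of_deriv_neg {f : ℝ → ℝ} {f' : ℝ} (hf : HasDerivAt f f' 0)
    (hf' : f' < 0) : ∃ M : ℝ, 0 < M ∧ ∀ δ : ℝ, 0 < δ → δ < M → f δ < f 0 := by
  have h := (hasDerivAt_iff_tendsto_slope.1 hf).eventually (gt_mem_nhds hf')
  rw [eventually_nhdsWithin_iff, Metric.eventually_nhds_iff] at h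
  obtain ⟨M, hM, h⟩ := h
  refine ⟨M, hM, fun δ h0 h1 => ?_⟩
  have hs := h (y := δ) (by simpa [abs_of_pos h0] using h1) h0.ne'
  rw [slope_def_field, sub_zero] at hs
  simpa [sub_neg] using (div_lt_iff₀ h0).1 hs

theorem exists_forall_lt_of_iteratedDeriv_neg {f : ℝ → ℝ} (hd : Differentiable ℝ f)
    (hf : deriv f 0 = 0) (hf' : iteratedDeriv 2 f 0 < 0) :
    ∃ M : ℝ, 0 < M ∧ ∀ δ : ℝ, 0 < δ → δ < M → f δ < f 0 := by
  rw [iteratedDeriv_succ, iteratedDeriv_one] at hf'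
  -- Since `deriv` defaults to 0, a nonzero value certifies that `deriv f` is differentiable at 0;
  -- it is thus negative just to the right of 0.
  obtain ⟨M, hM, h⟩ := exists_forall_lt_of_deriv_neg
    (differentiableAt_of_deriv_ne_zero hf'.ne).hasDerivAt hf'
  refine ⟨M, hM, fun δ h0 h1 => ?_⟩
  refine strictAntiOn_of_deriv_neg (convex_Icc 0 δ) hd.continuous.continuousOn (fun y hy => ?_)
    (Set.left_mem_Icc.2 h0.le) (Set.right_mem_Icc.2 h0.le) h0
  rw [interior_Icc] at hy
  simpa [hf] using h y hy.1 (hy.2.trans h1)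

end Descent

/-! ### Linear algebra of the factors. -/

section LinearAlgebra

/-- If `(a, c) ↦ W a + c 1` is injective, then it is surjective. -/
theorem exists_eq_mulVec_add_const {K d : ℕ} (hd : K ≤ d + 1) (W : Matrix (Fin K) (Fin d) ℝ)
    (hW : ∀ (a : Fin d → ℝ) (c : ℝ), (∀ j, (W *ᵥ a) j + c = 0) → a = 0 ∧ c = 0)
    (u : Fin K → ℝ) : ∃ (a : Fin d → ℝ) (c : ℝ), ∀ j, u j = (W *ᵥ a) j + c := by
  let f : (Fin d → ℝ) × ℝ →ₗ[ℝ] (Fin K → ℝ) :=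
    W.mulVecLin.coprod (LinearMap.toSpanSingleton ℝ _ 1)
  have hf (p : (Fin d → ℝ) × ℝ) (j : Fin K) : f p j = (W *ᵥ p.1) j + p.2 := by simp [f]
  have hinj : Function.Injective f := by
    refine (injective_iff_map_eq_zero f).2 fun p hp => ?_
    obtain ⟨h1, h2⟩ := hW p.1 p.2 fun j => by rw [← hf, hp, Pi.zero_apply]
    exact Prod.ext h1 h2
  -- Injectivity gives `d + 1 ≤ K`, so with `hd` the dimensions agree.
  have hle := LinearMap.finrank_le_finrank_of_injective hinj
  have hsurj : Function.Surjective f := by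
    refine (LinearMap.injective_iff_surjective_of_finrank_eq_finrank ?_).1 hinj
    simp only [Module.finrank_prod, Module.finrank_fin_fun, Module.finrank_self] at hle ⊢
    omega
  obtain ⟨p, hp⟩ := hsurj u
  exact ⟨p.1, p.2, fun j => by rw [← hf, hp]⟩

variable {m l : Type*} [Fintype m] [Fintype l]

theorem sum_mulVec_eq_zero {G : Matrix m l ℝ} (hG : ∀ x, ∑ j, G j x = 0)
    (v : l → ℝ) : ∑ j, (G *ᵥ v) j = 0 := by
  simp only [Matrix.mulVec, dotProduct]
  rw [Finset.sum_comm]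
  simp [← Finset.sum_mul, hG]

theorem dotProduct_self_nonneg (v : l → ℝ) : 0 ≤ v ⬝ᵥ v :=
  Finset.sum_nonneg fun _ _ => mul_self_nonneg _

theorem dotProduct_self_pos {v : l → ℝ} (hv : v ≠ 0) : 0 < v ⬝ᵥ v :=
  lt_of_le_of_ne (dotProduct_self_nonneg v) (Ne.symm (mt dotProduct_self_eq_zero.1 hv))

theorem frob_vecMulVec_self (u : m → ℝ) (v : l → ℝ) :
    frob (Matrix.vecMulVec u v) (Matrix.vecMulVec u v) = (u ⬝ᵥ u) * (v ⬝ᵥ v) := by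
  rw [frob_vecMulVec_right, Matrix.vecMulVec_mulVec]
  simp [mul_comm]

theorem dotProduct_mulVec_transpose (G : Matrix m l ℝ) (u : m → ℝ) :
    u ⬝ᵥ (G *ᵥ (Gᵀ *ᵥ u)) = (Gᵀ *ᵥ u) ⬝ᵥ (Gᵀ *ᵥ u) := by
  rw [Matrix.dotProduct_mulVec, Matrix.mulVec_transpose]

/-- If `Gᵀ G v = 0` then `‖G v‖² = 0`. The vector `u = G v` is wanted because its coordinates sum to
zero when the columns of `G` do. -/
theorem exists_transpose_mulVec_ne_zero {G : Matrix m l ℝ} (hG : G ≠ 0) :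
    ∃ v : l → ℝ, Gᵀ *ᵥ (G *ᵥ v) ≠ 0 := by
  classical
  by_contra! h
  refine hG (Matrix.ext_of_mulVec_single fun x => ?_)
  have h1 : (G *ᵥ Pi.single x 1) ⬝ᵥ (G *ᵥ Pi.single x 1) = 0 := by
    rw [Matrix.dotProduct_mulVec, ← Matrix.mulVec_transpose, h, zero_dotProduct]
  rw [dotProduct_self_eq_zero.1 h1, Matrix.zero_mulVec]

end LinearAlgebra

/-! ### Rank-one directions of negative curvature. -/

section NegativeCurvature

variable {K n d : ℕ}

theorem lineHess_vecMulVec (W : Classifiers K d) (H : Features K n d) (u : Fin K → ℝ)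
    (a : Fin d → ℝ) (r : ℝ) :
    lineHess W H (Matrix.vecMulVec u a)
        (r • Matrix.vecMulVec a ((logitGrad (W * H))ᵀ *ᵥ u)) =
      2 * r * (a ⬝ᵥ a) * (((logitGrad (W * H))ᵀ *ᵥ u) ⬝ᵥ ((logitGrad (W * H))ᵀ *ᵥ u)) +
        logitHess (W * H) (Matrix.vecMulVec u (a ᵥ* H) +
          r • Matrix.vecMulVec (W *ᵥ a) ((logitGrad (W * H))ᵀ *ᵥ u)) := by
  rw [lineHess, Matrix.mul_smul W, Matrix.mul_smul (Matrix.vecMulVec u a),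
    Matrix.vecMulVec_mul_vecMulVec, Matrix.vecMulVec_mul, Matrix.mul_vecMulVec, Matrix.vecMulVec_smul, frob_smul_right,
    frob_smul_right, frob_vecMulVec_right, dotProduct_mulVec_transpose]
  ring

/-- A point at which the gradient of the loss vanishes has a direction of negative curvature. -/
theorem exists_neg_of_grad_eq_zero (hK : 2 ≤ K) (hn : 1 ≤ n) (hd : K ≤ d + 1)
    (W : Classifiers K d) (H : Features K n d) (hH : logitGrad (W * H) * Hᵀ = 0)
    (hW : Wᵀ * logitGrad (W * H) = 0) :
    ∃ V F, frob W V + frob H F = 0 ∧ lineHess W H V F < 0 := by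
  set G := logitGrad (W * H) with hG
  -- Otherwise the range of `W` and the constants span everything; `G v` is orthogonal to both,
  -- hence zero for every `v`.
  obtain ⟨a, c, ha, hac⟩ : ∃ (a : Fin d → ℝ) (c : ℝ), a ≠ 0 ∧ ∀ j, (W *ᵥ a) j = c := by
    by_contra! hcon
    obtain ⟨v, hv⟩ := exists_transpose_mulVec_ne_zero (logitGrad_ne_zero hK hn (W * H))
    obtain ⟨a, c, hac⟩ := exists_eq_mulVec_add_const hd W (fun a c hac => by
      have ha : a = 0 := by
        by_contra ha
        obtain ⟨j, hj⟩ := hcon a (-c) ha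
        exact hj (eq_neg_of_add_eq_zero_left (hac j))
      refine ⟨ha, ?_⟩
      simpa [ha] using hac ⟨0, by omega⟩) (G *ᵥ v)
    have h0 : (G *ᵥ v) ⬝ᵥ (G *ᵥ v) = 0 := by
      have h1 : (G *ᵥ v) ⬝ᵥ (W *ᵥ a) = 0 := by
        rw [Matrix.dotProduct_mulVec, ← Matrix.mulVec_transpose, Matrix.mulVec_mulVec, hW]
        simp
      have h2 : (G *ᵥ v) ⬝ᵥ (G *ᵥ v) = (G *ᵥ v) ⬝ᵥ (W *ᵥ a) + (∑ j, (G *ᵥ v) j) * c := by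
        simp only [dotProduct]
        rw [Finset.sum_mul, ← Finset.sum_add_distrib]
        refine Finset.sum_congr rfl fun j _ => ?_
        nth_rewrite 2 [hac j]
        ring
      rw [h2, h1, sum_mulVec_eq_zero (sum_logitGrad _)]
      simp
    rw [← hG, dotProduct_self_eq_zero.1 h0] at hv
    simp at hv
  obtain ⟨v, hv⟩ := exists_transpose_mulVec_ne_zero (logitGrad_ne_zero hK hn (W * H))
  rw [← hG] at hv
  set u := G *ᵥ v with hu
  have hua : 0 < (a ⬝ᵥ a) * ((Gᵀ *ᵥ u) ⬝ᵥ (Gᵀ *ᵥ u)) :=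
    mul_pos (dotProduct_self_pos ha) (dotProduct_self_pos hv)
  set q := logitHess (W * H) (Matrix.vecMulVec u (a ᵥ* H)) with hq
  have hq0 : (0 : ℝ) ≤ |q| := abs_nonneg q
  obtain ⟨s, hs⟩ : ∃ s : ℝ, |q| < 2 * s * ((a ⬝ᵥ a) * ((Gᵀ *ᵥ u) ⬝ᵥ (Gᵀ *ᵥ u))) := by
    refine ⟨(|q| + 1) / (2 * ((a ⬝ᵥ a) * ((Gᵀ *ᵥ u) ⬝ᵥ (Gᵀ *ᵥ u)))), ?_⟩
    generalize (a ⬝ᵥ a) * ((Gᵀ *ᵥ u) ⬝ᵥ (Gᵀ *ᵥ u)) = y at hua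
    have : 2 * ((|q| + 1) / (2 * y)) * y = |q| + 1 := by field_simp
    linarith
  refine ⟨Matrix.vecMulVec u a, (-s) • Matrix.vecMulVec a (Gᵀ *ᵥ u), ?_, ?_⟩
  · have h1 : frob W (Matrix.vecMulVec u a) = 0 := by
      rw [frob_vecMulVec_right, funext hac]
      simp only [dotProduct]
      rw [← Finset.sum_mul, hu, sum_mulVec_eq_zero (sum_logitGrad _), zero_mul]
    have h2 : H *ᵥ (Gᵀ *ᵥ u) = 0 := by
      rw [Matrix.mulVec_mulVec]
      have := congrArg Matrix.transpose hH
      rw [Matrix.transpose_mul, Matrix.transpose_transpose, Matrix.transpose_zero] at this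
      rw [this, Matrix.zero_mulVec]
    rw [h1, frob_smul_right, frob_vecMulVec_right, h2]
    simp
  -- As `W a` is constant, the `s`-dependent part only shifts columns: the variance term stays `q`
  -- while the other term decreases linearly in `s`.
  · rw [lineHess_vecMulVec, logitHess_add_const (v := fun x => -s * (c * (Gᵀ *ᵥ u) x))]
    · rw [← hG, ← hq]
      nlinarith [le_abs_self q]
    · intro j x
      simp [Matrix.vecMulVec_apply, hac, hG]

/-- A critical point on the sphere at which the operator norm of the gradient with respect to the
logits exceeds the multiplier has a direction of negative curvature, if `W` is not injective. -/
theorem exists_neg_of_mulVec_eq_zero (W : Classifiers K d) (H : Features K n d) {lam : ℝ}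
    (hlam : 0 < lam) {a : Fin d → ℝ} (ha : a ≠ 0) (hWa : W *ᵥ a = 0) (hHa : a ᵥ* H = 0)
    {u : Fin K → ℝ} (hu : lam ^ 2 * (u ⬝ᵥ u) <
      ((logitGrad (W * H))ᵀ *ᵥ u) ⬝ᵥ ((logitGrad (W * H))ᵀ *ᵥ u)) :
    ∃ V F, frob W V + frob H F = 0 ∧ lineHess W H V F < 0 ∧
      lineHess W H V F + lam * (frob V V + frob F F) < 0 := by
  -- The factor `-lam⁻¹` minimises `2 r + lam r²`, the dependence of the spherical Hessian on the
  -- scale `r` of the second component.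
  have e : lineHess W H (Matrix.vecMulVec u a)
      ((-lam⁻¹) • Matrix.vecMulVec a ((logitGrad (W * H))ᵀ *ᵥ u)) = _ :=
    lineHess_vecMulVec W H u a (-lam⁻¹)
  set v := (logitGrad (W * H))ᵀ *ᵥ u with hv
  have ha' : 0 < a ⬝ᵥ a := dotProduct_self_pos ha
  have hlam' : 0 < lam⁻¹ := inv_pos.2 hlam
  have hz : Matrix.vecMulVec u (a ᵥ* H) + (-lam⁻¹) • Matrix.vecMulVec (W *ᵥ a) v = 0 := by
    ext j x
    simp [Matrix.vecMulVec_apply, hWa, hHa]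
  rw [hz, logitHess_zero, add_zero] at e
  have key : lineHess W H (Matrix.vecMulVec u a) ((-lam⁻¹) • Matrix.vecMulVec a v) +
      lam * (frob (Matrix.vecMulVec u a) (Matrix.vecMulVec u a) +
        frob ((-lam⁻¹) • Matrix.vecMulVec a v) ((-lam⁻¹) • Matrix.vecMulVec a v)) < 0 := by
    rw [e, frob_smul_left, frob_smul_right, frob_vecMulVec_self, frob_vecMulVec_self]
    have : 2 * -lam⁻¹ * (a ⬝ᵥ a) * (v ⬝ᵥ v) + lam * ((u ⬝ᵥ u) * (a ⬝ᵥ a) +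
        -lam⁻¹ * (-lam⁻¹ * ((a ⬝ᵥ a) * (v ⬝ᵥ v)))) =
        lam⁻¹ * (a ⬝ᵥ a) * (lam ^ 2 * (u ⬝ᵥ u) - v ⬝ᵥ v) := by
      field_simp
      ring
    rw [this]
    exact mul_neg_of_pos_of_neg (mul_pos hlam' ha') (by linarith)
  refine ⟨_, _, ?_, ?_, key⟩
  · rw [frob_smul_right, frob_vecMulVec_right, frob_vecMulVec_right, hWa,
      Matrix.dotProduct_mulVec, hHa]
    simp
  · have := mul_nonneg hlam.le (add_nonneg (frob_self_nonneg (Matrix.vecMulVec u a))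
      (frob_self_nonneg ((-lam⁻¹) • Matrix.vecMulVec a v)))
    linarith

end NegativeCurvature

/-! ### Small gradient norm forces neural collapse. -/

section NeuralCollapse

variable {K n d : ℕ}

theorem sum_eq_zero_of_mul_transpose_eq {G : Matrix (Fin K) (Fin K × Fin n) ℝ}
    (hG : ∀ x, ∑ j, G j x = 0) {W : Classifiers K d} {H : Features K n d} {lam : ℝ}
    (hlam : lam ≠ 0) (hW : G * Hᵀ = (-lam) • W) (b : Fin d) : ∑ j, W j b = 0 := by
  have h : ∑ j, (G * Hᵀ) j b = 0 := by
    simp only [Matrix.mul_apply]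
    rw [Finset.sum_comm]
    simp [← Finset.sum_mul, hG]
  rw [hW] at h
  simpa [← Finset.mul_sum, hlam] using h

/-- The product of two factors pairs with a matrix of operator norm at most `lam` to at least
`-lam / 2` times the sum of the squared norms of the factors. -/
theorem frob_mul_ge {G : Matrix (Fin K) (Fin K × Fin n) ℝ} {lam : ℝ} (hlam : 0 < lam)
    (hG : ∀ u : Fin K → ℝ, (Gᵀ *ᵥ u) ⬝ᵥ (Gᵀ *ᵥ u) ≤ lam ^ 2 * (u ⬝ᵥ u))
    (V : Classifiers K d) (F : Features K n d) :
    0 ≤ lam * (frob V V + frob F F) + 2 * frob G (V * F) := by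
  have h1 : frob (Vᵀ * G) (Vᵀ * G) ≤ lam ^ 2 * frob V V := by
    rw [frob_eq_sum, Finset.sum_comm, frob_eq_sum, Finset.mul_sum]
    refine Finset.sum_le_sum fun b _ => ?_
    have e (x) : (Vᵀ * G) b x = (Gᵀ *ᵥ fun j => V j b) x := by
      simp [Matrix.mul_apply, Matrix.mulVec, dotProduct, mul_comm]
    simp only [e]
    exact hG fun j => V j b
  -- Completing the square: expand, bound `‖Vᵀ G‖²` by `h1`, and divide by `lam`.
  have h2 := frob_self_nonneg (Vᵀ * G + lam • F)
  rw [frob_add_left, frob_add_right, frob_add_right, frob_smul_left, frob_smul_right,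
    frob_smul_left, frob_smul_right, frob_comm F, frob_transpose_mul_left V G F] at h2
  refine nonneg_of_mul_nonneg_right ?_ hlam
  nlinarith

/-- Permuting the scores together with the labels changes nothing; `τ` reorders the data points in
the same way in every class. -/
theorem logitLoss_submatrix (Z : Matrix (Fin K) (Fin K × Fin n) ℝ) (σ : Equiv.Perm (Fin K))
    (τ : Equiv.Perm (Fin n)) :
    logitLoss (Z.submatrix σ (σ.prodCongr τ)) = logitLoss Z := by
  refine Fintype.sum_equiv (σ.prodCongr τ) _ _ fun x => ?_
  simp only [Matrix.submatrix_apply]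
  rw [Equiv.sum_comp σ fun j => Real.exp (Z j (σ.prodCongr τ x))]
  rfl

theorem logitGrad_submatrix (Z : Matrix (Fin K) (Fin K × Fin n) ℝ) (σ : Equiv.Perm (Fin K))
    (τ : Equiv.Perm (Fin n)) :
    logitGrad (Z.submatrix σ (σ.prodCongr τ)) = (logitGrad Z).submatrix σ (σ.prodCongr τ) := by
  ext j x
  simp only [logitGrad, softmax, Matrix.submatrix_apply, Matrix.of_apply]
  rw [Equiv.sum_comp σ fun j => Real.exp (Z j (σ.prodCongr τ x))]
  simp

theorem frob_submatrix {m l : Type*} [Fintype m] [Fintype l] (A : Matrix m l ℝ)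
    (σ : Equiv.Perm m) (τ : Equiv.Perm l) :
    frob (A.submatrix σ τ) (A.submatrix σ τ) = frob A A := by
  simp only [frob_eq_sum, Matrix.submatrix_apply]
  rw [Equiv.sum_comp τ fun x => ∑ j, A (σ j) x * A (σ j) x]
  exact Finset.sum_congr rfl fun x _ => Equiv.sum_comp σ fun j => A j x * A j x

/-- A matrix with vanishing column sums which is invariant under permutations of the classes and of
the data points is a multiple of that of a simplex equiangular tight frame. -/
theorem exists_eq_of_submatrix_eq (hK : 2 ≤ K) (hn : 1 ≤ n)
    {M : Matrix (Fin K) (Fin K × Fin n) ℝ} (hM : ∀ x, ∑ j, M j x = 0)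
    (h : ∀ (σ : Equiv.Perm (Fin K)) (τ : Equiv.Perm (Fin n)),
      M.submatrix σ (σ.prodCongr τ) = M) :
    ∃ c : ℝ, ∀ j k i, M j (k, i) = c * ((if j = k then (K : ℝ) else 0) - 1) := by
  have h' (σ : Equiv.Perm (Fin K)) (τ : Equiv.Perm (Fin n)) (j k i) :
      M (σ j) (σ k, τ i) = M j (k, i) := congrFun (congrFun (h σ τ) j) (k, i)
  have hK' : (0 : ℝ) < K - 1 := by
    have : (2 : ℝ) ≤ K := by exact_mod_cast hK
    linarith
  let k₀ : Fin K := ⟨0, by omega⟩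
  let i₀ : Fin n := ⟨0, by omega⟩
  have hdiag (k i) : M k (k, i) = M k₀ (k₀, i₀) := by
    simpa using (h' (Equiv.swap k k₀) (Equiv.swap i i₀) k k i).symm
  refine ⟨M k₀ (k₀, i₀) / (K - 1), fun j k i => ?_⟩
  by_cases hjk : j = k
  · subst hjk
    rw [if_pos rfl, hdiag, div_mul_cancel₀ _ hK'.ne']
  -- Swapping two classes other than `k` fixes column class `k`, so all off-diagonal entries agree
  -- and the zero column sum determines them.
  · have hoff : ∀ j' ∈ Finset.univ.erase k, M j' (k, i) = M j (k, i) := fun j' hj' => by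
      simpa [Equiv.swap_apply_of_ne_of_ne (Finset.ne_of_mem_erase hj').symm (Ne.symm hjk)] using
        (h' (Equiv.swap j' j) 1 j' k i).symm
    have hs := hM (k, i)
    rw [← Finset.add_sum_erase _ _ (Finset.mem_univ k), Finset.sum_congr rfl hoff, hdiag,
      Finset.sum_const, Finset.card_erase_of_mem (Finset.mem_univ k), Finset.card_univ,
      Fintype.card_fin, nsmul_eq_mul, Nat.cast_sub (by omega), Nat.cast_one] at hs
    rw [if_neg hjk]
    field_simp
    linarith

/-- The logits of a critical point whose gradient has operator norm at most the multiplier are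
invariant under permutations. -/
theorem submatrix_mul_eq (W : Classifiers K d) (H : Features K n d) {lam : ℝ} (hlam : 0 < lam)
    (hW : logitGrad (W * H) * Hᵀ = (-lam) • W) (hH : Wᵀ * logitGrad (W * H) = (-lam) • H)
    (hop : ∀ u : Fin K → ℝ, ((logitGrad (W * H))ᵀ *ᵥ u) ⬝ᵥ ((logitGrad (W * H))ᵀ *ᵥ u) ≤
      lam ^ 2 * (u ⬝ᵥ u)) (σ : Equiv.Perm (Fin K)) (τ : Equiv.Perm (Fin n)) :
    (W * H).submatrix σ (σ.prodCongr τ) = W * H := by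
  have h1 := frob_mul_ge hlam hop (W.submatrix σ (Equiv.refl (Fin d)))
    (H.submatrix (Equiv.refl (Fin d)) (σ.prodCongr τ))
  rw [Matrix.submatrix_mul_equiv, frob_submatrix W σ (Equiv.refl _),
    frob_submatrix H (Equiv.refl _) (σ.prodCongr τ)] at h1
  have h2 : frob (logitGrad (W * H)) (W * H) = -lam * frob W W := by
    rw [← frob_mul_transpose_left, hW, frob_smul_left]
  have h3 : frob (logitGrad (W * H)) (W * H) = -lam * frob H H := by
    rw [← frob_transpose_mul_left, hH, frob_smul_left]
  have hcol (x) : ∑ j, (W * H) j x = 0 := by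
    simp only [Matrix.mul_apply]
    rw [Finset.sum_comm]
    simp [← Finset.sum_mul, sum_eq_zero_of_mul_transpose_eq (sum_logitGrad _) hlam.ne' hW]
  ext j x
  -- The permuted factors have the same norms, so `h1` with `h2` and `h3` gives `⟨G, Z'⟩ ≥ ⟨G, Z⟩`;
  -- the losses agree, so this is the equality case of convexity.
  obtain ⟨c, hc⟩ := eq_const_of_logitLoss_le
    (Z := W * H) (Z' := (W * H).submatrix σ (σ.prodCongr τ)) (by
      rw [logitLoss_submatrix, frob_sub_right]
      linarith) x
  have hc0 : ∑ j : Fin K, c = 0 := by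
    rw [← Finset.sum_congr rfl fun j _ => hc j, Finset.sum_sub_distrib, hcol]
    simp only [Matrix.submatrix_apply]
    rw [Equiv.sum_comp σ fun j => (W * H) j (σ.prodCongr τ x), hcol, sub_zero]
  have hcz : c = 0 := by
    have hK : (K : ℝ) ≠ 0 := by
      have := j.pos
      positivity
    simpa [hK] using hc0
  linarith [hc j]

theorem isNeuralCollapse_of_feature_eq (hK : 2 ≤ K) (hn : 1 ≤ n) (W : Classifiers K d)
    (H : Features K n d) {r c : ℝ} (hr : 0 < r) (hc : 0 < c)
    (hH : ∀ k i, feature H k i = r • classifier W k)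
    (hW : ∀ j k, inner ℝ (classifier W j) (classifier W k) =
      c * ((if j = k then (K : ℝ) else 0) - 1)) :
    IsNeuralCollapse W H := by
  have hK' : (0 : ℝ) < K - 1 := by
    have : (2 : ℝ) ≤ K := by exact_mod_cast hK
    linarith
  have hmean (k) : classMean H k = r • classifier W k := by
    have hn' : (n : ℝ) ≠ 0 := by positivity
    simp only [classMean, hH, Finset.sum_const, Finset.card_univ, Fintype.card_fin]
    rw [← Nat.cast_smul_eq_nsmul ℝ, smul_smul, inv_mul_cancel₀ hn', one_smul]
  have hnorm (k) : ‖classifier W k‖ ^ 2 = c * (K - 1) := by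
    rw [← real_inner_self_eq_norm_sq, hW, if_pos rfl]
  have hnorm' (j k) : ‖classifier W j‖ = ‖classifier W k‖ :=
    (sq_eq_sq₀ (norm_nonneg _) (norm_nonneg _)).1 (by rw [hnorm, hnorm])
  refine ⟨fun k i => ?_, fun k j hkj => ⟨?_, ?_⟩, ⟨r⁻¹, inv_pos.2 hr, fun k => ?_⟩, fun h k => ?_⟩
  · rw [hH, hmean, sub_self, norm_zero]
  · rw [hmean, hmean, InnerProductGeometry.angle_smul_left_of_pos _ _ hr,
      InnerProductGeometry.angle_smul_right_of_pos _ _ hr, InnerProductGeometry.cos_angle, hW,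
      if_neg hkj, hnorm' j k, ← sq, hnorm]
    field_simp
    ring
  · rw [hmean, hmean, norm_smul, norm_smul, hnorm' k j]
  · rw [hmean, smul_smul, inv_mul_cancel₀ hr.ne', one_smul]
  -- With equal norms, the squared distances differ only in the term `-2 r ⟨w, h⟩`.
  · refine forall_congr' fun j => ?_
    rw [← sq_le_sq₀ (norm_nonneg _) (norm_nonneg _), hmean, hmean, norm_sub_sq_real,
      norm_sub_sq_real, norm_smul, norm_smul, hnorm' j k, inner_smul_right, inner_smul_right,
      real_inner_comm h, real_inner_comm h]
    constructor
    · intro hj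
      nlinarith
    · intro hj
      nlinarith

/-- Invariance makes logits and gradient multiples `c`, `g` of the simplex pattern. As the
classifiers sum to zero, `Wᵀ * G = -lam • H` then turns every feature into `-g K / lam` times its
classifier. -/
theorem isNeuralCollapse_of_grad_le (hK : 2 ≤ K) (hn : 1 ≤ n) (W : Classifiers K d)
    (H : Features K n d) {lam : ℝ} (hlam : 0 < lam) (hW0 : W ≠ 0)
    (hW : logitGrad (W * H) * Hᵀ = (-lam) • W) (hH : Wᵀ * logitGrad (W * H) = (-lam) • H)
    (hop : ∀ u : Fin K → ℝ, ((logitGrad (W * H))ᵀ *ᵥ u) ⬝ᵥ ((logitGrad (W * H))ᵀ *ᵥ u) ≤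
      lam ^ 2 * (u ⬝ᵥ u)) :
    IsNeuralCollapse W H := by
  have hinv := submatrix_mul_eq W H hlam hW hH hop
  have hWsum := sum_eq_zero_of_mul_transpose_eq (sum_logitGrad _) hlam.ne' hW
  have hcol (x) : ∑ j, (W * H) j x = 0 := by
    simp only [Matrix.mul_apply]
    rw [Finset.sum_comm]
    simp [← Finset.sum_mul, hWsum]
  obtain ⟨c, hc⟩ := exists_eq_of_submatrix_eq hK hn hcol hinv
  obtain ⟨g, hg⟩ := exists_eq_of_submatrix_eq hK hn (sum_logitGrad (W * H))
    fun σ τ => by rw [← logitGrad_submatrix, hinv]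
  have hK0 : (0 : ℝ) < K := by positivity
  have hg0 : g < 0 := by
    have h1 := hg ⟨0, by omega⟩ ⟨1, by omega⟩ ⟨0, by omega⟩
    have h2 := softmax_pos (W * H) ⟨0, by omega⟩ (⟨1, by omega⟩, ⟨0, by omega⟩)
    simp [logitGrad] at h1
    linarith
  have hr : 0 < -g * K / lam := div_pos (mul_pos (neg_pos.2 hg0) hK0) hlam
  have hHW (b k i) : H b (k, i) = -g * K / lam * W k b := by
    have h1 : (Wᵀ * logitGrad (W * H)) b (k, i) = -lam * H b (k, i) := by rw [hH]; rfl
    have h2 : (Wᵀ * logitGrad (W * H)) b (k, i) = g * K * W k b := by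
      simp only [Matrix.mul_apply, Matrix.transpose_apply, hg]
      have : ∀ j, W j b * (g * ((if j = k then (K : ℝ) else 0) - 1)) =
          (if j = k then g * K * W j b else 0) - g * W j b := fun j => by
        split_ifs <;> ring
      simp only [this]
      rw [Finset.sum_sub_distrib, ← Finset.mul_sum, hWsum]
      simp
    rw [h1] at h2
    field_simp
    linarith
  set r := -g * K / lam with hrdef
  have hinner (j k) : r * inner ℝ (classifier W j) (classifier W k) =
      c * ((if j = k then (K : ℝ) else 0) - 1) := by
    rw [← hc j k ⟨0, by omega⟩]
    simp only [Matrix.mul_apply, hHW, classifier, PiLp.inner_apply, Finset.mul_sum]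
    refine Finset.sum_congr rfl fun b _ => ?_
    simp
    ring
  have hc0 : 0 < c := by
    obtain ⟨k, hk⟩ : ∃ k, classifier W k ≠ 0 := by
      by_contra! h
      refine hW0 (Matrix.ext fun k b => ?_)
      exact congrArg (fun v : EuclideanSpace ℝ (Fin d) => v b) (h k)
    have h1 := hinner k k
    rw [if_pos rfl, real_inner_self_eq_norm_sq] at h1
    have h2 : 0 < r * ‖classifier W k‖ ^ 2 := by
      have := norm_pos_iff.2 hk
      positivity
    have hK' : (0 : ℝ) < K - 1 := by
      have : (2 : ℝ) ≤ K := by exact_mod_cast hK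
      linarith
    rw [h1] at h2
    exact (pos_iff_pos_of_mul_pos h2).2 hK'
  refine isNeuralCollapse_of_feature_eq hK hn W H hr (div_pos hc0 hr) (fun k i => ?_)
    fun j k => ?_
  · ext b
    simp [feature, classifier, hHW]
  · rw [div_mul_eq_mul_div, ← hinner]
    field_simp

end NeuralCollapse

/-! ### Critical points, spheres and the strict saddle property. -/

section Main

variable {K n d : ℕ}

theorem mem_tangentSpace {W V : Classifiers K d} {H F : Features K n d} :
    (V, F) ∈ tangentSpace W H ↔ frob W V + frob H F = 0 := Iff.rfl

theorem normSq_eq_frob (W : Classifiers K d) (H : Features K n d) :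
    normSq W H = frob W W + frob H H := by
  rw [normSq, frob_self, frob_self]

theorem normSq_pos {W : Classifiers K d} {H : Features K n d} (h : (W, H) ≠ 0) :
    0 < normSq W H := by
  refine lt_of_le_of_ne (by unfold normSq; positivity) fun h0 => h ?_
  rw [normSq] at h0
  have hW : ‖W‖ ^ 2 = 0 := by linarith [sq_nonneg ‖W‖, sq_nonneg ‖H‖]
  have hH : ‖H‖ ^ 2 = 0 := by linarith [sq_nonneg ‖W‖, sq_nonneg ‖H‖]
  exact Prod.ext (norm_eq_zero.1 (sq_eq_zero_iff.1 hW)) (norm_eq_zero.1 (sq_eq_zero_iff.1 hH))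

theorem normSq_smul (r : ℝ) (W : Classifiers K d) (H : Features K n d) :
    normSq (r • W) (r • H) = r ^ 2 * normSq W H := by
  simp only [normSq_eq_frob, frob_smul_left, frob_smul_right]
  ring

/-- At a critical point in the tangent space the gradient is a multiple of the point. -/
theorem IsTangentCritical.exists_multiplier {W : Classifiers K d} {H : Features K n d}
    (h : IsTangentCritical W H) :
    ∃ lam : ℝ, ((W, H) = 0 → lam = 0) ∧ logitGrad (W * H) * Hᵀ = (-lam) • W ∧
      Wᵀ * logitGrad (W * H) = (-lam) • H := by
  by_cases h0 : (W, H) = 0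
  · obtain ⟨rfl, rfl⟩ := Prod.mk.inj h0
    exact ⟨0, fun _ => rfl, by simp, by simp⟩
  set G := logitGrad (W * H) with hG
  have hN := normSq_pos h0
  rw [normSq_eq_frob] at hN
  -- This `lam` makes `(V, F)` the projection of the gradient to the tangent space; the derivative
  -- in that direction is its own squared norm, hence zero.
  set lam := -(2 * frob G (W * H)) / (frob W W + frob H H) with hlam
  have hlamN : lam * (frob W W + frob H H) = -(2 * frob G (W * H)) :=
    div_mul_cancel₀ _ hN.ne'
  set V := G * Hᵀ + lam • W with hV
  set F := Wᵀ * G + lam • H with hF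
  have hVF : frob W V + frob H F = 0 := by
    rw [hV, hF, frob_add_right, frob_add_right, frob_comm W, frob_comm H,
      frob_mul_transpose_left, frob_transpose_mul_left, frob_smul_right, frob_smul_right]
    linarith
  have hd := h (V, F) (mem_tangentSpace.2 hVF)
  rw [(hasDerivAt_loss_line W V H F).deriv, frob_add_right, ← frob_mul_transpose_left,
    ← frob_transpose_mul_left, ← hG] at hd
  have hsum : frob V V + frob F F = 0 := by
    have e1 : frob V V = frob (G * Hᵀ) V + lam * frob W V := by
      conv_lhs => rw [hV, frob_add_left, frob_smul_left, ← hV]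
    have e2 : frob F F = frob (Wᵀ * G) F + lam * frob H F := by
      conv_lhs => rw [hF, frob_add_left, frob_smul_left, ← hF]
    rw [e1, e2]
    linear_combination hd + lam * hVF
  have hV0 : V = 0 :=
    frob_self_eq_zero.1 (by linarith [frob_self_nonneg V, frob_self_nonneg F])
  have hF0 : F = 0 :=
    frob_self_eq_zero.1 (by linarith [frob_self_nonneg V, frob_self_nonneg F])
  exact ⟨lam, fun h => absurd h h0, by rw [neg_smul]; exact eq_neg_of_add_eq_zero_left hV0,
    by rw [neg_smul]; exact eq_neg_of_add_eq_zero_left hF0⟩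

/-- A critical point that is not a balanced neural collapse solution has a direction in which both
the Hessian and the Hessian with the curvature term of the sphere are negative. -/
theorem exists_neg_direction (hK : 2 ≤ K) (hn : 1 ≤ n) (hd : K ≤ d + 1) (W : Classifiers K d)
    (H : Features K n d) (hWH : ¬ IsNeuralCollapse W H ∨ ‖W‖ ≠ ‖H‖) {lam : ℝ}
    (hlam : (W, H) = 0 → lam = 0) (hW : logitGrad (W * H) * Hᵀ = (-lam) • W)
    (hH : Wᵀ * logitGrad (W * H) = (-lam) • H) :
    ∃ V F, frob W V + frob H F = 0 ∧ lineHess W H V F < 0 ∧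
      lineHess W H V F + lam * (frob V V + frob F F) < 0 := by
  rcases eq_or_ne lam 0 with rfl | hlam0
  · obtain ⟨V, F, h1, h2⟩ := exists_neg_of_grad_eq_zero hK hn hd W H (by simpa using hW)
      (by simpa using hH)
    exact ⟨V, F, h1, h2, by simpa using h2⟩
  have h2 : frob (logitGrad (W * H)) (W * H) = -lam * frob W W := by
    rw [← frob_mul_transpose_left, hW, frob_smul_left]
  have h3 : frob (logitGrad (W * H)) (W * H) = -lam * frob H H := by
    rw [← frob_transpose_mul_left, hH, frob_smul_left]
  have hbal : frob W W = frob H H := mul_left_cancel₀ (neg_ne_zero.2 hlam0) (h2.symm.trans h3)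
  have hWpos : 0 < frob W W := by
    have := normSq_pos (mt hlam hlam0)
    rw [normSq_eq_frob] at this
    linarith
  rcases hlam0.lt_or_gt with hneg | hpos
  · have hL : lineHess W H W (-H) = 2 * (lam * frob W W) := by
      rw [lineHess, Matrix.mul_neg, add_neg_cancel, logitHess_zero, frob_neg_right, h2]
      ring
    have hlt : lam * frob W W < 0 := mul_neg_of_neg_of_pos hneg hWpos
    refine ⟨W, -H, ?_, by linarith, ?_⟩
    · rw [frob_neg_right, hbal, add_neg_cancel]
    · have : frob (-H) (-H) = frob H H := by simp [frob]
      rw [this, ← hbal, hL]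
      linarith
  have hnc : ¬ IsNeuralCollapse W H := by
    refine hWH.resolve_right (not_not.2 ?_)
    rw [frob_self, frob_self] at hbal
    exact (sq_eq_sq₀ (norm_nonneg _) (norm_nonneg _)).1 hbal
  -- Both sides arise from `Wᵀ * G * Hᵀ` by using one critical equation or the other. Hence `‖W a‖ =
  -- ‖Hᵀ a‖` for all `a`.
  have hgram : Wᵀ * W = H * Hᵀ := by
    have h4 : Wᵀ * (logitGrad (W * H) * Hᵀ) = Wᵀ * logitGrad (W * H) * Hᵀ :=
      (Matrix.mul_assoc _ _ _).symm
    rw [hW, hH, Matrix.mul_smul, Matrix.smul_mul] at h4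
    exact smul_right_injective _ (neg_ne_zero.2 hlam0) h4
  have hsq (a : Fin d → ℝ) : (W *ᵥ a) ⬝ᵥ (W *ᵥ a) = (Hᵀ *ᵥ a) ⬝ᵥ (Hᵀ *ᵥ a) := by
    rw [← dotProduct_mulVec_transpose, Matrix.mulVec_mulVec, ← hgram, ← Matrix.mulVec_mulVec]
    simpa using (dotProduct_mulVec_transpose Wᵀ a).symm
  have hWsum := sum_eq_zero_of_mul_transpose_eq (sum_logitGrad _) hlam0 hW
  have hWsum' (a : Fin d → ℝ) : ∑ j, (W *ᵥ a) j = 0 := by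
    simp only [Matrix.mulVec, dotProduct]
    rw [Finset.sum_comm]
    simp [← Finset.sum_mul, hWsum]
  obtain ⟨u, hu⟩ : ∃ u : Fin K → ℝ, lam ^ 2 * (u ⬝ᵥ u) <
      ((logitGrad (W * H))ᵀ *ᵥ u) ⬝ᵥ ((logitGrad (W * H))ᵀ *ᵥ u) := by
    by_contra! hop
    exact hnc (isNeuralCollapse_of_grad_le hK hn W H hpos (fun h => hWpos.ne'
      (frob_self_eq_zero.2 h)) hW hH hop)
  obtain ⟨a, ha, hWa⟩ : ∃ a : Fin d → ℝ, a ≠ 0 ∧ W *ᵥ a = 0 := by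
    by_contra! hinj
    obtain ⟨a, c, hac⟩ := exists_eq_mulVec_add_const hd W (fun a c hac => by
      have hc : c = 0 := by
        have : ∑ j, ((W *ᵥ a) j + c) = 0 := Finset.sum_eq_zero fun j _ => hac j
        rw [Finset.sum_add_distrib, hWsum'] at this
        simpa [show K ≠ 0 by omega] using this
      refine ⟨?_, hc⟩
      by_contra ha
      exact hinj a ha (funext fun j => by simpa [hc] using hac j)) u
    -- Constants are killed by `Gᵀ`, so `‖Gᵀ u‖ = lam ‖Hᵀ a‖ = lam ‖W a‖ ≤ lam ‖u‖`, against the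
    -- choice of `u`.
    have hGu : (logitGrad (W * H))ᵀ *ᵥ u = (-lam) • (Hᵀ *ᵥ a) := by
      have e1 : (logitGrad (W * H))ᵀ *ᵥ u = (logitGrad (W * H))ᵀ *ᵥ (W *ᵥ a) := by
        ext x
        simp only [Matrix.mulVec, dotProduct, Matrix.transpose_apply]
        have : ∀ j, logitGrad (W * H) j x * u j =
            logitGrad (W * H) j x * (W *ᵥ a) j + logitGrad (W * H) j x * c := fun j => by
          rw [hac j, mul_add]
        simp only [this, Finset.sum_add_distrib, ← Finset.sum_mul, sum_logitGrad]
        simp [Matrix.mulVec, dotProduct]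
      have e2 : (logitGrad (W * H))ᵀ * W = (-lam) • Hᵀ := by
        rw [← Matrix.transpose_smul, ← hH, Matrix.transpose_mul, Matrix.transpose_transpose]
      rw [e1, Matrix.mulVec_mulVec, e2, Matrix.smul_mulVec]
    have huu : u ⬝ᵥ u = (W *ᵥ a) ⬝ᵥ (W *ᵥ a) + K * c ^ 2 := by
      have : ∀ j, u j * u j = (W *ᵥ a) j * (W *ᵥ a) j + 2 * c * (W *ᵥ a) j + c ^ 2 := fun j => by
        rw [hac j]; ring
      simp only [dotProduct, this, Finset.sum_add_distrib, ← Finset.mul_sum, hWsum']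
      simp
    rw [hGu, huu, hsq, smul_dotProduct, dotProduct_smul] at hu
    simp only [smul_eq_mul] at hu
    have : 0 ≤ lam ^ 2 * (K * c ^ 2) := by positivity
    nlinarith
  have hHa : a ᵥ* H = 0 := by
    rw [← Matrix.mulVec_transpose]
    refine dotProduct_self_eq_zero.1 ?_
    rw [← hsq, hWa, zero_dotProduct]
  exact exists_neg_of_mulVec_eq_zero W H hpos ha hWa hHa hu

theorem normSq_circle {W V : Classifiers K d} {H F : Features K n d}
    (hT : (V, F) ∈ tangentSpace W H) (hN : normSq V F = normSq W H) (t : ℝ) :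
    normSq (Real.cos t • W + Real.sin t • V) (Real.cos t • H + Real.sin t • F) = normSq W H := by
  rw [mem_tangentSpace] at hT
  rw [normSq_eq_frob, normSq_eq_frob W] at *
  simp only [frob_add_left, frob_add_right, frob_smul_left, frob_smul_right, frob_comm V W,
    frob_comm F H]
  linear_combination (2 * Real.cos t * Real.sin t) * hT + Real.sin t ^ 2 * hN +
    (frob W W + frob H H) * Real.sin_sq_add_cos_sq t

theorem exists_circle_near {W V : Classifiers K d} {H F : Features K n d}
    (hT : (V, F) ∈ tangentSpace W H) (hN : normSq V F = normSq W H)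
    (hlt : ∃ M : ℝ, 0 < M ∧ ∀ δ : ℝ, 0 < δ → δ < M →
      loss (Real.cos δ • W + Real.sin δ • V) (Real.cos δ • H + Real.sin δ • F) < loss W H)
    {ε : ℝ} (hε : 0 < ε) :
    ∃ (W' : Classifiers K d) (H' : Features K n d),
      ‖W'‖ ^ 2 + ‖H'‖ ^ 2 = ‖W‖ ^ 2 + ‖H‖ ^ 2 ∧ ‖W' - W‖ ^ 2 + ‖H' - H‖ ^ 2 < ε ∧
        loss W' H' < loss W H := by
  obtain ⟨M, hM, h⟩ := hlt
  -- The squared distance from `(W, H)` to the point of the circle at angle `t`.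
  let f : ℝ → ℝ := fun t => ((Real.cos t - 1) ^ 2 + Real.sin t ^ 2) * normSq W H
  have hf : Continuous f := by fun_prop
  have hf0 : f 0 < ε := by simpa [f] using hε
  obtain ⟨r, hr, hr'⟩ := Metric.eventually_nhds_iff.1 (hf.continuousAt.eventually (gt_mem_nhds hf0))
  have hm : 0 < min M r := lt_min hM hr
  set t := min M r / 2 with ht
  have ht0 : 0 < t := half_pos hm
  have htm : t < min M r := half_lt_self hm
  refine ⟨_, _, normSq_circle hT hN t, ?_, h t ht0 (htm.trans_le (min_le_left _ _))⟩
  have hft : f t < ε :=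
    hr' (by simpa [abs_of_pos ht0] using htm.trans_le (min_le_right _ _))
  convert hft using 1
  have e1 : Real.cos t • W + Real.sin t • V - W = (Real.cos t - 1) • W + Real.sin t • V := by
    rw [sub_smul, one_smul]; abel
  have e2 : Real.cos t • H + Real.sin t • F - H = (Real.cos t - 1) • H + Real.sin t • F := by
    rw [sub_smul, one_smul]; abel
  rw [mem_tangentSpace] at hT
  rw [e1, e2, ← frob_self, ← frob_self]
  simp only [f]
  rw [normSq_eq_frob, normSq_eq_frob W] at *
  simp only [frob_add_left, frob_add_right, frob_smul_left, frob_smul_right, frob_comm V W,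
    frob_comm F H]
  linear_combination (2 * (Real.cos t - 1) * Real.sin t) * hT + Real.sin t ^ 2 * hN

/-- Tangent directions can be rescaled to the radius of the sphere. -/
theorem exists_smul_normSq_eq {V W : Classifiers K d} {F H : Features K n d} (h0 : (W, H) ≠ 0)
    (hVF : (V, F) ≠ 0) :
    ∃ r : ℝ, 0 < r ∧ r ^ 2 * normSq V F = normSq W H ∧ normSq (r • V) (r • F) = normSq W H := by
  have h1 := normSq_pos h0
  have h2 := normSq_pos hVF
  have h3 : Real.sqrt (normSq W H / normSq V F) ^ 2 * normSq V F = normSq W H := by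
    rw [Real.sq_sqrt (div_pos h1 h2).le, div_mul_cancel₀ _ h2.ne']
  exact ⟨_, Real.sqrt_pos.2 (div_pos h1 h2), h3, by rw [normSq_smul, h3]⟩

theorem smul_mem_tangentSpace {W V : Classifiers K d} {H F : Features K n d} (r : ℝ)
    (hT : (V, F) ∈ tangentSpace W H) : (r • V, r • F) ∈ tangentSpace W H := by
  rw [mem_tangentSpace] at *
  rw [frob_smul_right, frob_smul_right, ← mul_add, hT, mul_zero]

theorem isTangentStrictSaddle (hK : 2 ≤ K) (hn : 1 ≤ n) (hd : K ≤ d + 1)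
    {W : Classifiers K d} {H : Features K n d} (hWH : ¬ IsNeuralCollapse W H ∨ ‖W‖ ≠ ‖H‖)
    (hc : IsTangentCritical W H) : IsTangentStrictSaddle W H := by
  obtain ⟨lam, hlam, hW, hH⟩ := hc.exists_multiplier
  obtain ⟨V, F, hT, hneg, hneg'⟩ := exists_neg_direction hK hn hd W H hWH hlam hW hH
  have hT' : (V, F) ∈ tangentSpace W H := mem_tangentSpace.2 hT
  refine ⟨hc, ⟨(V, F), hT', by rwa [iteratedDeriv_loss_line]⟩, fun h0 => ?_⟩
  have hVF : (V, F) ≠ 0 := by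
    intro h
    obtain ⟨rfl, rfl⟩ := Prod.mk.inj h
    simp [lineHess, frob_zero_right, logitHess_zero] at hneg
  obtain ⟨r, hr, hrN, hrN'⟩ := exists_smul_normSq_eq h0 hVF
  refine ⟨(r • V, r • F), smul_mem_tangentSpace r hT', hrN', ?_⟩
  have h2 : frob (logitGrad (W * H)) (W * H) = -lam * frob W W := by
    rw [← frob_mul_transpose_left, hW, frob_smul_left]
  have h3 : frob (logitGrad (W * H)) (W * H) = -lam * frob H H := by
    rw [← frob_transpose_mul_left, hH, frob_smul_left]
  rw [iteratedDeriv_loss_circle, lineHess_smul]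
  rw [normSq_eq_frob, normSq_eq_frob] at hrN
  -- The critical equations turn the acceleration term into `lam * normSq W H`, which the choice of
  -- `r` rewrites as `lam * r ^ 2 * normSq V F`.
  have e : r ^ 2 * lineHess W H V F - 2 * frob (logitGrad (W * H)) (W * H) =
      r ^ 2 * (lineHess W H V F + lam * (frob V V + frob F F)) := by
    linear_combination -h2 - h3 - lam * hrN
  rw [e]
  exact mul_neg_of_pos_of_neg (by positivity) hneg'

theorem IsTangentStrictSaddle.exists_descent {W : Classifiers K d} {H : Features K n d}
    (h : IsTangentStrictSaddle W H) :
    ∃ Δ ∈ tangentSpace W H, ∃ M : ℝ, 0 < M ∧ ∀ δ : ℝ, 0 < δ → δ < M →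
      loss (W + δ • Δ.1) (H + δ • Δ.2) < loss W H := by
  obtain ⟨hc, ⟨Δ, hT, hneg⟩, -⟩ := h
  refine ⟨Δ, hT, ?_⟩
  simpa using exists_forall_lt_of_iteratedDeriv_neg
    (differentiable_loss_line W Δ.1 H Δ.2) (hc Δ hT) hneg

theorem IsTangentStrictSaddle.exists_lt_near {W : Classifiers K d} {H : Features K n d}
    (h : IsTangentStrictSaddle W H) (h0 : (W, H) ≠ 0) {ε : ℝ} (hε : 0 < ε) :
    ∃ (W' : Classifiers K d) (H' : Features K n d),
      ‖W'‖ ^ 2 + ‖H'‖ ^ 2 = ‖W‖ ^ 2 + ‖H‖ ^ 2 ∧ ‖W' - W‖ ^ 2 + ‖H' - H‖ ^ 2 < ε ∧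
        loss W' H' < loss W H := by
  obtain ⟨Δ, hT, hN, hneg⟩ := h.2.2 h0
  refine exists_circle_near hT hN ?_ hε
  have hc := h.1 Δ hT
  rw [(hasDerivAt_loss_line W Δ.1 H Δ.2).deriv,
    ← (hasDerivAt_loss_circle W Δ.1 H Δ.2).deriv] at hc
  simpa using exists_forall_lt_of_iteratedDeriv_neg
    (differentiable_loss_circle W Δ.1 H Δ.2) hc hneg

/-- At a point that is not critical in the tangent space there is a direction of descent. -/
theorem exists_descent_of_not_isTangentCritical {W : Classifiers K d} {H : Features K n d}
    (h : ¬ IsTangentCritical W H) :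
    ∃ V F, (V, F) ∈ tangentSpace W H ∧ frob (logitGrad (W * H)) (V * H + W * F) < 0 := by
  simp only [IsTangentCritical, not_forall] at h
  obtain ⟨⟨V, F⟩, hT, hne⟩ := h
  rw [(hasDerivAt_loss_line W V H F).deriv] at hne
  rcases lt_or_gt_of_ne hne with hlt | hgt
  · exact ⟨V, F, hT, hlt⟩
  · refine ⟨(-1 : ℝ) • V, (-1 : ℝ) • F, smul_mem_tangentSpace _ hT, ?_⟩
    rw [Matrix.smul_mul, Matrix.mul_smul, ← smul_add, frob_smul_right]
    linarith

end Main

end ULPM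

theorem mainTheorem5 (K n d : ℕ) (hK : 2 ≤ K) (hn : 1 ≤ n) (hd : K ≤ d + 1)
    (W : ULPM.Classifiers K d) (H : ULPM.Features K n d)
    (hWH : ¬ ULPM.IsNeuralCollapse W H ∨ ‖W‖ ≠ ‖H‖) :
    (∃ Δ ∈ ULPM.tangentSpace W H, ∃ M : ℝ, 0 < M ∧ ∀ δ : ℝ, 0 < δ → δ < M →
      ULPM.loss (W + δ • Δ.1) (H + δ • Δ.2) < ULPM.loss W H) ∧
    ((W, H) ≠ 0 → ∀ ε : ℝ, 0 < ε →
      ∃ (W' : ULPM.Classifiers K d) (H' : ULPM.Features K n d),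
        ‖W'‖ ^ 2 + ‖H'‖ ^ 2 = ‖W‖ ^ 2 + ‖H‖ ^ 2 ∧
        ‖W' - W‖ ^ 2 + ‖H' - H‖ ^ 2 < ε ∧
        ULPM.loss W' H' < ULPM.loss W H) ∧
    (ULPM.IsTangentCritical W H → ULPM.IsTangentStrictSaddle W H) := by
  by_cases hc : ULPM.IsTangentCritical W H
  · have hs := ULPM.isTangentStrictSaddle hK hn hd hWH hc
    exact ⟨hs.exists_descent, fun h0 ε hε => hs.exists_lt_near h0 hε, fun _ => hs⟩
  obtain ⟨V, F, hT, hneg⟩ := ULPM.exists_descent_of_not_isTangentCritical hc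
  refine ⟨⟨(V, F), hT, ?_⟩, fun h0 ε hε => ?_, fun h => absurd h hc⟩
  · simpa using ULPM.exists_forall_lt_of_deriv_neg (ULPM.hasDerivAt_loss_line W V H F) hneg
  · have hVF : (V, F) ≠ 0 := by
      intro h
      obtain ⟨rfl, rfl⟩ := Prod.mk.inj h
      simp [ULPM.frob_zero_right] at hneg
    obtain ⟨r, hr, -, hN⟩ := ULPM.exists_smul_normSq_eq h0 hVF
    refine ULPM.exists_circle_near (ULPM.smul_mem_tangentSpace r hT) hN ?_ hε
    have hneg' : ULPM.frob (ULPM.logitGrad (W * H)) ((r • V) * H + W * (r • F)) < 0 := by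
      rw [Matrix.smul_mul, Matrix.mul_smul, ← smul_add, ULPM.frob_smul_right]
      exact mul_neg_of_pos_of_neg hr hneg
    simpa using ULPM.exists_forall_lt_of_deriv_neg
      (ULPM.hasDerivAt_loss_circle W (r • V) H (r • F)) hneg'
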